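/- Let $a>b>0$, let $\mathcal{E}$ be the ellipse $x^2/a^2+y^2/b^2=1$ in the Euclidean plane, and put $c=\sqrt{a^2-b^2}$. Let $\mathcal{K}$ be a circle of radius $r>0$ with center $C=(x_c,y_c)$ such that the closed disk bounded by $\mathcal{K}$ lies in the open region bounded by $\mathcal{E}$, and suppose that $\mathcal{K}$ is a caustic of Poncelet triangles of $\mathcal{E}$, i.e. there is a (nondegenerate) triangle with vertices on $\mathcal{E}$ whose three side lines are tangent to $\mathcal{K}$. Let $\mathcal{L}_8$ be the locus of the Nagel point $X_8$ (the common point of the lines joining each vertex to the point where the opposite side touches the corresponding excircle) over all triangles with vertices on $\mathcal{E}$ and side lines tangent to $\mathcal{K}$. Put \[ \delta=\sqrt{(b^4+c^2y_c^2)(a^4-c^2x_c^2)},\qquad \delta_8=(a^3b+ab^3-2\delta)^2+4c^4x_c^2y_c^2, \] \[ a_8=\frac{\sqrt{\delta_8}}{b\,c^2},\qquad b_8=\frac{\sqrt{\delta_8}}{a\,c^2}. \] If $\delta_8\neq 0$, then $a_8,b_8>0$ and $\mathcal{L}_8$ is the whole ellipse $x^2/a_8^2+y^2/b_8^2=1$;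 it is concentric with and homothetic to $\mathcal{E}$, i.e. it is the image of $\mathcal{E}$ under a homothety with positive ratio about the center of $\mathcal{E}$. If $\delta_8=0$, then $\mathcal{L}_8$ degenerates to the single point $\{(0,0)\}$, the center of $\mathcal{E}$. -/

import Mathlib

/-- The Euclidean plane. -/
abbrev Plane := EuclideanSpace ℝ (Fin 2)

/-- The axis-parallel ellipse centred at the origin whose semi-axes along the first and second
coordinate axes are `a` and `b` (used for `0 < a` and `0 < b` only). -/
def ellipse (a b : ℝ) : Set Plane := {p | (p 0) ^ 2 / a ^ 2 + (p 1) ^ 2 / b ^ 2 = 1}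

/-- The open region bounded by `ellipse a b`. -/
def ellipseInterior (a b : ℝ) : Set Plane := {p | (p 0) ^ 2 / a ^ 2 + (p 1) ^ 2 / b ^ 2 < 1}

/-- `t` is a (nondegenerate) triangle interscribed between the curve `E` and the circle `K`:
its vertices lie on `E` and its side lines are tangent to the caustic `K`. -/
def IsPonceletTriangle (E : Set Plane) (K : EuclideanGeometry.Sphere Plane)
    (t : Affine.Triangle ℝ Plane) : Prop :=
  (∀ i, t.points i ∈ E) ∧
    ∀ i j, i ≠ j → K.IsTangent (affineSpan ℝ {t.points i, t.points j})

/-- `X` is the Nagel point of `t`: it lies on each line joining a vertex to the point where the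
opposite side touches its excircle (the excircle across from that vertex). -/
def IsNagelPoint (t : Affine.Triangle ℝ Plane) (X : Plane) : Prop :=
  ∀ i, X ∈ affineSpan ℝ {t.points i, t.touchpoint {i} i}

/-- The locus of the Nagel point over all Poncelet triangles interscribed between `E` and `K`. -/
def nagelLocus (E : Set Plane) (K : EuclideanGeometry.Sphere Plane) : Set Plane :=
  {X | ∃ t : Affine.Triangle ℝ Plane, IsPonceletTriangle E K t ∧ IsNagelPoint t X}

/-! Rescaling the axes turns the outer ellipse into the unit circle and the caustic circle into an
ellipse with foci `f`, `g`. The line through `z`, `w` on the unit circle is `p + z w conj p - z - w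
= 0`, and the product of the distances from the foci to a tangent is the squared minor semi-axis, so
tangency of the chord `z w` becomes an algebraic relation (`isTangent_chord_iff`). Three distinct
points in this relation pairwise have elementary symmetric functions determined by their product
`l`: they are the roots of the Blaschke equation `z (z - f) (z - g) = l (1 - conj f z) (1 - conj g
z)` with `|l| = 1`. Conversely, under the closure condition `4 r² / a² = (1 - |f|²) (1 - |g|²)`,
every unimodular `l` yields a Poncelet triangle. In both directions the vertex sum is `f + g + l
conj f conj g`.

The nested caustic must be the incircle, and the Nagel point is `A + B + C - 2 I`. This expression
passes through the linear chart, where `2 I` is `f + g`; what remains is `l conj f conj g`. The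
locus is thus a circle of radius `|f g|` in the chart, hence an ellipse homothetic to the outer one,
or a point when `f g = 0`. Solving the closure condition for `r` expresses `|f g|` through `δ8`
(`poncelet_radius_relation`). -/

/-! ### Blaschke triples on the unit circle -/

/-- If the elementary symmetric functions of `z₁`, `z₂`, `z₃` are those of the roots of
`z (z - f) (z - g) = t (1 - f' z) (1 - g' z)`, then the chord `z₁ z₂` is tangent to a fixed conic
with foci `f` and `g`. -/
theorem chord_relation_of_symm {f g f' g' z₁ z₂ z₃ : ℂ}
    (h1 : z₁ + z₂ + z₃ = f + g + z₁ * z₂ * z₃ * (f' * g'))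
    (h2 : z₁ * z₂ + z₁ * z₃ + z₂ * z₃ = f * g + z₁ * z₂ * z₃ * (f' + g')) (hz : z₃ ≠ 0) :
    (f + z₁ * z₂ * f' - z₁ - z₂) * (g + z₁ * z₂ * g' - z₁ - z₂)
      = (1 - f * f') * (1 - g * g') * (z₁ * z₂) := by
  apply mul_left_cancel₀ hz
  linear_combination (z₃ * (z₁ + z₂ - z₁ * z₂ * (f' + g'))) * h1 -
    z₃ * (1 - z₁ * z₂ * f' * g') * h2

/-- For fixed `z₁` the chord relation is a quadratic in the other endpoint, with roots `z₂`, `z₃`.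
Comparing the product of the roots with the constant and leading coefficients gives the Blaschke
equation at `z₁`; `m` enters only the linear coefficient and drops out. -/
theorem mul_eq_of_chord_relations {f g f' g' m z₁ z₂ z₃ : ℂ} (h23 : z₂ ≠ z₃)
    (h2 : (f + z₁ * z₂ * f' - z₁ - z₂) * (g + z₁ * z₂ * g' - z₁ - z₂) = m * (z₁ * z₂))
    (h3 : (f + z₁ * z₃ * f' - z₁ - z₃) * (g + z₁ * z₃ * g' - z₁ - z₃) = m * (z₁ * z₃)) :
    z₁ * (z₁ - f) * (z₁ - g) = z₁ * z₂ * z₃ * (1 - f' * z₁) * (1 - g' * z₁) := by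
  apply mul_left_cancel₀ (sub_ne_zero.2 h23)
  linear_combination z₁ * z₂ * h3 - z₁ * z₃ * h2

/-- Three distinct points with pairwise tangent chords have prescribed elementary symmetric
functions. -/
theorem symm_of_chord_relations {f g f' g' m z₁ z₂ z₃ : ℂ}
    (n12 : z₁ ≠ z₂) (n13 : z₁ ≠ z₃) (n23 : z₂ ≠ z₃)
    (h12 : (f + z₁ * z₂ * f' - z₁ - z₂) * (g + z₁ * z₂ * g' - z₁ - z₂) = m * (z₁ * z₂))
    (h13 : (f + z₁ * z₃ * f' - z₁ - z₃) * (g + z₁ * z₃ * g' - z₁ - z₃) = m * (z₁ * z₃))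
    (h23 : (f + z₂ * z₃ * f' - z₂ - z₃) * (g + z₂ * z₃ * g' - z₂ - z₃) = m * (z₂ * z₃)) :
    z₁ + z₂ + z₃ = f + g + z₁ * z₂ * z₃ * (f' * g') ∧
      z₁ * z₂ + z₁ * z₃ + z₂ * z₃ = f * g + z₁ * z₂ * z₃ * (f' + g') := by
  have c1 := mul_eq_of_chord_relations n23 h12 h13
  have c2 := mul_eq_of_chord_relations (f := f) (g := g) (z₁ := z₂) (f' := f') (g' := g')
    (m := m) n13 (by linear_combination h12) h23
  have c3 := mul_eq_of_chord_relations (f := f) (g := g) (f' := f') (g' := g') (z₁ := z₃)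
    (m := m) n12 (by linear_combination h13) (by linear_combination h23)
  -- Divided difference of the monic cubic of which all three points are roots; a second difference
  -- then isolates `z₁ + z₂ + z₃`.
  have d12 : z₁ ^ 2 + z₁ * z₂ + z₂ ^ 2 - (f + g + z₁ * z₂ * z₃ * (f' * g')) * (z₁ + z₂) +
      (f * g + z₁ * z₂ * z₃ * (f' + g')) = 0 := by
    apply mul_left_cancel₀ (sub_ne_zero.2 n12)
    linear_combination c1 - c2
  have d13 : z₁ ^ 2 + z₁ * z₃ + z₃ ^ 2 - (f + g + z₁ * z₂ * z₃ * (f' * g')) * (z₁ + z₃) +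
      (f * g + z₁ * z₂ * z₃ * (f' + g')) = 0 := by
    apply mul_left_cancel₀ (sub_ne_zero.2 n13)
    linear_combination c1 - c3
  have e1 : z₁ + z₂ + z₃ = f + g + z₁ * z₂ * z₃ * (f' * g') := by
    apply mul_left_cancel₀ (sub_ne_zero.2 n23)
    linear_combination d12 - d13
  exact ⟨e1, by linear_combination (z₁ + z₂) * e1 - d12⟩

open scoped ComplexConjugate

/-- For `|f| < 1` this compares `|z - f|` with `|1 - conj f z|` according to the side of the unit
circle on which `z` lies. -/
theorem normSq_one_sub_conj_mul (f z : ℂ) :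
    Complex.normSq (1 - conj f * z) =
      Complex.normSq (z - f) + (1 - Complex.normSq f) * (1 - Complex.normSq z) := by
  simp only [Complex.normSq_apply, Complex.sub_re, Complex.sub_im, Complex.mul_re, Complex.mul_im,
    Complex.conj_re, Complex.conj_im, Complex.one_re, Complex.one_im]
  ring

/-- Solutions of `B(z) = t`, with `B` the Blaschke product with zeros `0`, `f`, `g` and `|t| = 1`,
lie on the unit circle. -/
theorem normSq_eq_one_of_blaschke {f g t z : ℂ} (hf : Complex.normSq f < 1)
    (hg : Complex.normSq g < 1) (ht : Complex.normSq t = 1)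
    (h : z * (z - f) * (z - g) = t * (1 - conj f * z) * (1 - conj g * z)) :
    Complex.normSq z = 1 := by
  have hn := congrArg Complex.normSq h
  have hA := Complex.normSq_nonneg (1 - conj f * z)
  have hB := Complex.normSq_nonneg (1 - conj g * z)
  simp only [map_mul, ht, one_mul, normSq_one_sub_conj_mul] at hn hA hB
  have hF := Complex.normSq_nonneg (z - f)
  have hG := Complex.normSq_nonneg (z - g)
  have hx := sub_pos.2 hf
  have hy := sub_pos.2 hg
  by_contra hne
  -- Inside the circle the left side of `h` has the smaller modulus, outside it the larger.
  rcases lt_or_gt_of_ne hne with hlt | hgt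
  · generalize Complex.normSq (z - f) = F at *
    generalize Complex.normSq (z - g) = G at *
    generalize Complex.normSq z = Z at *
    have hz := sub_pos.2 hlt
    have := mul_pos (mul_pos hx hz) (mul_pos hy hz)
    have := mul_nonneg (mul_nonneg hF hG) hz.le
    have := mul_nonneg hF (mul_pos hy hz).le
    have := mul_nonneg hG (mul_pos hx hz).le
    linarith
  · have hF : 0 < Complex.normSq (z - f) :=
      Complex.normSq_pos.2 (sub_ne_zero.2 (by rintro rfl; linarith))
    have hG : 0 < Complex.normSq (z - g) :=
      Complex.normSq_pos.2 (sub_ne_zero.2 (by rintro rfl; linarith))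
    generalize Complex.normSq (z - f) = F at *
    generalize Complex.normSq (z - g) = G at *
    generalize Complex.normSq z = Z at *
    have hz := sub_pos.2 hgt
    have := mul_pos (mul_pos hF hG) hz
    have := mul_le_mul (a := F + (1 - Complex.normSq f) * (1 - Z)) (b := F)
      (c := G + (1 - Complex.normSq g) * (1 - Z)) (d := G)
      (by linarith [mul_pos hx hz]) (by linarith [mul_pos hy hz]) hB hF.le
    linarith

/-- A chord of the unit circle tangent to an ellipse with foci inside the circle is not
degenerate. -/
theorem ne_of_chord_relation {f g z w : ℂ} (hf : Complex.normSq f < 1)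
    (hg : Complex.normSq g < 1) (hz : Complex.normSq z = 1)
    (h : (f + z * w * conj f - z - w) * (g + z * w * conj g - z - w)
      = (1 - f * conj f) * (1 - g * conj g) * (z * w)) : z ≠ w := by
  rintro rfl
  have hzz : z * conj z = 1 := by rw [Complex.mul_conj, hz, Complex.ofReal_one]
  have hz0 : z ≠ 0 := by rintro rfl; simp at hz
  -- For `w = z` each factor is `-z` times a real number exceeding `1 - |f|²` by `|1 - conj f z|²`,
  -- which is positive, so the product is too large: the tangent at `z` misses the inner ellipse.
  have aux : ∀ f : ℂ, f + z * z * conj f - z - z =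
      -z * ((1 - Complex.normSq f + Complex.normSq (1 - conj f * z) : ℝ) : ℂ) := by
    intro f
    push_cast
    rw [← Complex.mul_conj, ← Complex.mul_conj]
    simp only [map_sub, map_mul, map_one, Complex.conj_conj]
    linear_combination (- f + f * conj f * z) * hzz
  rw [aux, aux] at h
  have h' : ((1 - Complex.normSq f + Complex.normSq (1 - conj f * z)) *
      (1 - Complex.normSq g + Complex.normSq (1 - conj g * z)) : ℝ) =
      (1 - Complex.normSq f) * (1 - Complex.normSq g) := by
    apply Complex.ofReal_injective
    apply mul_left_cancel₀ (mul_ne_zero hz0 hz0)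
    push_cast at h ⊢
    rw [Complex.mul_conj, Complex.mul_conj] at h
    linear_combination h
  have hpos : 0 < Complex.normSq (1 - conj f * z) := by
    rw [Complex.normSq_pos]
    intro h0
    have : conj f * z = 1 := by linear_combination -h0
    have := congrArg Complex.normSq this
    rw [map_mul, hz, Complex.normSq_conj, map_one] at this
    linarith
  have hG := Complex.normSq_nonneg (1 - conj g * z)
  have := mul_pos hpos (sub_pos.2 hg)
  have := mul_nonneg (sub_pos.2 hf).le hG
  have := mul_nonneg hpos.le hG
  nlinarith

/-- The roots of `z (z - f) (z - g) = t (1 - conj f z) (1 - conj g z)`, by Vieta. -/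
theorem exists_symm_triple (f g t : ℂ) : ∃ z₁ z₂ z₃ : ℂ,
    z₁ + z₂ + z₃ = f + g + t * (conj f * conj g) ∧
    z₁ * z₂ + z₁ * z₃ + z₂ * z₃ = f * g + t * (conj f + conj g) ∧ z₁ * z₂ * z₃ = t := by
  let P : Cubic ℂ := ⟨1, -(f + g + t * (conj f * conj g)), f * g + t * (conj f + conj g), -t⟩
  have ha : P.a ≠ 0 := one_ne_zero
  obtain ⟨x, y, z, h⟩ := (Cubic.splits_iff_roots_eq_three (φ := RingHom.id ℂ) ha).1
    (IsAlgClosed.splits _)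
  have hb := Cubic.b_eq_three_roots ha h
  have hc := Cubic.c_eq_three_roots ha h
  have hd := Cubic.d_eq_three_roots ha h
  simp only [P, RingHom.id_apply] at hb hc hd
  exact ⟨x, y, z, by linear_combination hb, by linear_combination -hc, by linear_combination hd⟩

/-- A closed Poncelet triple on the unit circle with prescribed product. -/
theorem exists_poncelet_triple {f g t : ℂ} (hf : Complex.normSq f < 1)
    (hg : Complex.normSq g < 1) (ht : Complex.normSq t = 1) : ∃ z : Fin 3 → ℂ,
    z 0 + z 1 + z 2 = f + g + t * (conj f * conj g) ∧
    (∀ i, Complex.normSq (z i) = 1) ∧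
    ∀ i j, i ≠ j → z i ≠ z j ∧ (f + z i * z j * conj f - z i - z j) *
      (g + z i * z j * conj g - z i - z j) = (1 - f * conj f) * (1 - g * conj g) * (z i * z j) := by
  obtain ⟨z₁, z₂, z₃, h1, h2, h3⟩ := exists_symm_triple f g t
  have n1 : Complex.normSq z₁ = 1 := normSq_eq_one_of_blaschke hf hg ht (by
    linear_combination (z₁ ^ 2) * h1 - z₁ * h2 + h3)
  have n2 : Complex.normSq z₂ = 1 := normSq_eq_one_of_blaschke hf hg ht (by
    linear_combination (z₂ ^ 2) * h1 - z₂ * h2 + h3)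
  have n3 : Complex.normSq z₃ = 1 := normSq_eq_one_of_blaschke hf hg ht (by
    linear_combination (z₃ ^ 2) * h1 - z₃ * h2 + h3)
  have ne0 : ∀ {z : ℂ}, Complex.normSq z = 1 → z ≠ 0 := by rintro z hz rfl; simp at hz
  subst h3
  have r12 := chord_relation_of_symm h1 h2 (ne0 n3)
  have r13 := chord_relation_of_symm (z₁ := z₁) (z₂ := z₃) (z₃ := z₂) (f := f) (g := g)
    (f' := conj f) (g' := conj g)
    (by linear_combination h1) (by linear_combination h2) (ne0 n2)
  have r23 := chord_relation_of_symm (z₁ := z₂) (z₂ := z₃) (z₃ := z₁) (f := f) (g := g)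
    (f' := conj f) (g' := conj g)
    (by linear_combination h1) (by linear_combination h2) (ne0 n1)
  have d12 := ne_of_chord_relation hf hg n1 r12
  have d13 := ne_of_chord_relation hf hg n1 r13
  have d23 := ne_of_chord_relation hf hg n2 r23
  refine ⟨![z₁, z₂, z₃], h1, ?_, ?_⟩
  · intro i; fin_cases i <;> assumption
  · intro i j hij
    fin_cases i <;> fin_cases j <;> first | exact absurd rfl hij | skip
    · exact ⟨d12, r12⟩
    · exact ⟨d13, r13⟩
    · exact ⟨d12.symm, by simpa [mul_comm, sub_right_comm] using r12⟩
    · exact ⟨d23, r23⟩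
    · exact ⟨d13.symm, by simpa [mul_comm, sub_right_comm] using r13⟩
    · exact ⟨d23.symm, by simpa [mul_comm, sub_right_comm] using r23⟩

/-! ### Tangent lengths, the incenter and the Nagel point -/

namespace Affine.Triangle

section Touchpoints

variable {V P : Type*} [NormedAddCommGroup V] [InnerProductSpace ℝ V] [MetricSpace P]
  [NormedAddTorsor V P]

theorem point_mem_affineSpan_faceOpposite (t : Triangle ℝ P) {l m : Fin 3} (h : l ≠ m) :
    t.points l ∈ affineSpan ℝ (Set.range (t.faceOpposite m).points) := by
  apply mem_affineSpan
  rw [Simplex.range_faceOpposite_points]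
  exact ⟨l, h, rfl⟩

/-- The tangent lengths of an excircle. -/
theorem two_mul_dist_touchpoint_singleton (t : Triangle ℝ P)
    {i j k : Fin 3} (hij : i ≠ j) (hik : i ≠ k) (hjk : j ≠ k) :
    2 * dist (t.points j) (t.touchpoint {i} i) =
      dist (t.points j) (t.points k) + dist (t.points i) (t.points k) -
        dist (t.points i) (t.points j) := by
  have hm := fun {l m : Fin 3} ↦ t.point_mem_affineSpan_faceOpposite (l := l) (m := m)
  have ht := fun l ↦ (t.excenterExists {i}).isTangentAt_touchpoint l
  -- Equal tangents from each vertex, plus the position of each touchpoint on its side line, give a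
  -- linear system for the tangent lengths.
  have hi := (ht j).dist_eq_of_mem_of_mem (ht k) (hm hij) (hm hik)
  have hj := (ht i).dist_eq_of_mem_of_mem (ht k) (hm hij.symm) (hm hjk)
  have hk := (ht i).dist_eq_of_mem_of_mem (ht j) (hm hik.symm) (hm hjk.symm)
  have b1 := (t.sbtw_touchpoint_singleton hij.symm hjk hik).wbtw.dist_add_dist
  have b2 := (t.touchpoint_singleton_sbtw hij hik hjk).wbtw.dist_add_dist
  have b3 := (t.touchpoint_singleton_sbtw hik hij hjk.symm).wbtw.dist_add_dist
  rw [dist_comm _ (t.points k)] at b1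
  rw [dist_comm _ (t.points k), dist_comm _ (t.points i), dist_comm _ (t.points i)] at b2
  rw [dist_comm _ (t.points j), dist_comm _ (t.points i), dist_comm _ (t.points i)] at b3
  linarith

/-- The tangent lengths of the incircle. -/
theorem two_mul_dist_touchpoint_empty (t : Triangle ℝ P)
    {i j k : Fin 3} (hij : i ≠ j) (hik : i ≠ k) (hjk : j ≠ k) :
    2 * dist (t.points j) (t.touchpoint ∅ i) =
      dist (t.points j) (t.points k) + dist (t.points i) (t.points j) -
        dist (t.points i) (t.points k) := by
  have hm := fun {l m : Fin 3} ↦ t.point_mem_affineSpan_faceOpposite (l := l) (m := m)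
  have ht := fun l ↦ (t.excenterExists ∅).isTangentAt_touchpoint l
  have hi := (ht j).dist_eq_of_mem_of_mem (ht k) (hm hij) (hm hik)
  have hj := (ht i).dist_eq_of_mem_of_mem (ht k) (hm hij.symm) (hm hjk)
  have hk := (ht i).dist_eq_of_mem_of_mem (ht j) (hm hik.symm) (hm hjk.symm)
  have b1 := (t.sbtw_touchpoint_empty hij.symm hjk hik).wbtw.dist_add_dist
  have b2 := (t.sbtw_touchpoint_empty hij hik hjk).wbtw.dist_add_dist
  have b3 := (t.sbtw_touchpoint_empty hik hij hjk.symm).wbtw.dist_add_dist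
  rw [dist_comm _ (t.points k)] at b1 b2
  rw [dist_comm _ (t.points j)] at b3
  linarith

theorem dist_add_dist_sub_dist_pos (t : Triangle ℝ P)
    {i j k : Fin 3} (hij : i ≠ j) (hik : i ≠ k) (hjk : j ≠ k) :
    0 < dist (t.points j) (t.points k) + dist (t.points i) (t.points j) -
        dist (t.points i) (t.points k) := by
  rw [← two_mul_dist_touchpoint_empty t hij hik hjk]
  exact mul_pos two_pos (dist_pos.2 (t.sbtw_touchpoint_empty hij.symm hjk hik).left_ne)

/-- The power of a vertex with respect to the incircle. -/
theorem four_mul_dist_incenter_sq (t : Triangle ℝ P)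
    {i j k : Fin 3} (hij : i ≠ j) (hik : i ≠ k) (hjk : j ≠ k) :
    4 * dist (t.points j) t.incenter ^ 2 = 4 * t.inradius ^ 2 +
      (dist (t.points j) (t.points k) + dist (t.points i) (t.points j) -
        dist (t.points i) (t.points k)) ^ 2 := by
  rw [← two_mul_dist_touchpoint_empty t hij hik hjk]
  have := (t.isTangentAt_insphere_touchpoint i).dist_sq_eq_of_mem
    (t.point_mem_affineSpan_faceOpposite hij.symm)
  rw [Simplex.insphere_center, Simplex.insphere_radius] at this
  linarith

end Touchpoints

variable {V : Type*} [NormedAddCommGroup V] [InnerProductSpace ℝ V]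

open scoped RealInnerProductSpace

theorem two_mul_inner_sub_sub (x y z : V) :
    2 * ⟪x - z, y - z⟫ = dist x z ^ 2 + dist y z ^ 2 - dist x y ^ 2 := by
  have h := norm_sub_sq_real (x - z) (y - z)
  rw [sub_sub_sub_cancel_right] at h
  rw [dist_eq_norm, dist_eq_norm, dist_eq_norm]
  linarith

/-- The incenter is the weighted mean of the vertices, the weights being the side lengths. -/
theorem perimeter_smul_incenter (t : Triangle ℝ V) :
    (dist (t.points 1) (t.points 2) + dist (t.points 0) (t.points 2) +
        dist (t.points 0) (t.points 1)) • t.incenter =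
      dist (t.points 1) (t.points 2) • t.points 0 + dist (t.points 0) (t.points 2) • t.points 1 +
        dist (t.points 0) (t.points 1) • t.points 2 := by
  have q0 := t.four_mul_dist_incenter_sq (i := 1) (j := 0) (k := 2) (by decide) (by decide)
    (by decide)
  have q1 := t.four_mul_dist_incenter_sq (i := 0) (j := 1) (k := 2) (by decide) (by decide)
    (by decide)
  have q2 := t.four_mul_dist_incenter_sq (i := 0) (j := 2) (k := 1) (by decide) (by decide)
    (by decide)
  have p0 := t.dist_add_dist_sub_dist_pos (i := 1) (j := 0) (k := 2) (by decide) (by decide)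
    (by decide)
  have p1 := t.dist_add_dist_sub_dist_pos (i := 0) (j := 1) (k := 2) (by decide) (by decide)
    (by decide)
  have p2 := t.dist_add_dist_sub_dist_pos (i := 0) (j := 2) (k := 1) (by decide) (by decide)
    (by decide)
  have hw := t.excenterExists_empty.sum_excenterWeights_eq_one
  have hI : t.incenter = ∑ i, t.excenterWeights ∅ i • t.points i := by
    rw [t.incenter_eq_affineCombination, Finset.affineCombination_eq_linear_combination _ _ _ hw]
  simp only [Nat.reduceAdd, Fin.sum_univ_three] at hw hI
  have i1 := two_mul_inner_sub_sub t.incenter (t.points 1) (t.points 0)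
  have i2 := two_mul_inner_sub_sub t.incenter (t.points 2) (t.points 0)
  have i12 := two_mul_inner_sub_sub (t.points 1) (t.points 2) (t.points 0)
  have i11 := two_mul_inner_sub_sub (t.points 1) (t.points 1) (t.points 0)
  have i22 := two_mul_inner_sub_sub (t.points 2) (t.points 2) (t.points 0)
  generalize t.excenterWeights ∅ 0 = x₀ at *
  generalize t.excenterWeights ∅ 1 = x₁ at *
  generalize t.excenterWeights ∅ 2 = x₂ at *
  obtain rfl : x₀ = 1 - x₁ - x₂ := by linarith
  have hI0 : t.incenter - t.points 0 = x₁ • (t.points 1 - t.points 0) +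
      x₂ • (t.points 2 - t.points 0) := by
    rw [hI]
    module
  rw [dist_comm t.incenter, dist_comm t.incenter, hI0, inner_add_left, real_inner_smul_left,
    real_inner_smul_left] at i1 i2
  rw [real_inner_comm] at i12
  have i21 := i12
  rw [real_inner_comm] at i21
  simp only [dist_self, dist_comm (t.points 1) (t.points 0), dist_comm (t.points 2) (t.points 0),
    dist_comm (t.points 2) (t.points 1)] at *
  have hx : x₁ * (dist (t.points 1) (t.points 2) + dist (t.points 0) (t.points 2) +
        dist (t.points 0) (t.points 1)) = dist (t.points 0) (t.points 2) ∧
      x₂ * (dist (t.points 1) (t.points 2) + dist (t.points 0) (t.points 2) +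
        dist (t.points 0) (t.points 1)) = dist (t.points 0) (t.points 1) := by
    generalize ⟪t.points 1 - t.points 0, t.points 1 - t.points 0⟫ = U₁₁ at *
    generalize ⟪t.points 2 - t.points 0, t.points 2 - t.points 0⟫ = U₂₂ at *
    generalize ⟪t.points 1 - t.points 0, t.points 2 - t.points 0⟫ = U₁₂ at *
    generalize ⟪t.points 2 - t.points 0, t.points 1 - t.points 0⟫ = U₂₁ at *
    generalize dist (t.points 1) (t.points 2) = a at *
    generalize dist (t.points 0) (t.points 2) = b at *
    generalize dist (t.points 0) (t.points 1) = c at *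
    -- Pairing `I - A` with the two edges at `A` gives a linear system for the barycentric weights;
    -- the inradius cancels between the powers of two vertices.
    have e1 : 2 * x₁ * c ^ 2 + x₂ * (c ^ 2 + b ^ 2 - a ^ 2) = c * (b + c - a) := by
      linear_combination i1 - x₁ * i11 - x₂ * i12 + q0 / 4 - q1 / 4
    have e2 : x₁ * (c ^ 2 + b ^ 2 - a ^ 2) + 2 * x₂ * b ^ 2 = b * (b + c - a) := by
      linear_combination i2 - x₁ * i21 - x₂ * i22 + q0 / 4 - q2 / 4
    -- The determinant of the system, sixteen times the squared area by Heron.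
    have hΔ : (b + c - a) * (a + c - b) * (a + b - c) * (a + b + c) ≠ 0 := by
      have : 0 < (b + c - a) * (a + c - b) * (a + b - c) * (a + b + c) :=
        mul_pos (mul_pos (mul_pos p0 p1) p2) (by linarith)
      exact this.ne'
    constructor
    · apply mul_left_cancel₀ hΔ
      linear_combination (a + b + c) * (2 * b ^ 2 * e1 - (c ^ 2 + b ^ 2 - a ^ 2) * e2)
    · apply mul_left_cancel₀ hΔ
      linear_combination (a + b + c) * (2 * c ^ 2 * e2 - (c ^ 2 + b ^ 2 - a ^ 2) * e1)
  nth_rewrite 1 [hI]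
  rw [smul_add, smul_add, smul_smul, smul_smul, smul_smul]
  congr 1
  · congr 1
    · congr 1
      linear_combination -hx.1 - hx.2
    · rw [mul_comm, hx.1]
  · rw [mul_comm, hx.2]

theorem dist_smul_touchpoint_singleton (t : Triangle ℝ V)
    {i j k : Fin 3} (hij : i ≠ j) (hik : i ≠ k) (hjk : j ≠ k) :
    (2 * dist (t.points j) (t.points k)) • t.touchpoint {i} i =
      (dist (t.points i) (t.points j) + dist (t.points j) (t.points k) -
        dist (t.points i) (t.points k)) • t.points j +
      (dist (t.points i) (t.points k) + dist (t.points j) (t.points k) -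
        dist (t.points i) (t.points j)) • t.points k := by
  have h := t.two_mul_dist_touchpoint_singleton hij hik hjk
  obtain ⟨x, hx, hT⟩ := (t.sbtw_touchpoint_singleton hij.symm hjk hik).wbtw
  rw [← hT, dist_left_lineMap, Real.norm_of_nonneg hx.1] at h
  rw [← hT, AffineMap.lineMap_apply_module]
  match_scalars
  · linear_combination -h
  · linear_combination h

/-- The Nagel point of a triangle with vertices `A`, `B`, `C` and incenter `I` is
`A + B + C - 2 I`. -/
theorem forall_mem_affineSpan_touchpoint_iff (t : Triangle ℝ V) (X : V) :
    (∀ i, X ∈ affineSpan ℝ {t.points i, t.touchpoint {i} i}) ↔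
      X = t.points 0 + t.points 1 + t.points 2 - (2 : ℝ) • t.incenter := by
  have p0 := t.dist_add_dist_sub_dist_pos (i := 1) (j := 0) (k := 2) (by decide) (by decide)
    (by decide)
  have p1 := t.dist_add_dist_sub_dist_pos (i := 0) (j := 1) (k := 2) (by decide) (by decide)
    (by decide)
  have p2 := t.dist_add_dist_sub_dist_pos (i := 0) (j := 2) (k := 1) (by decide) (by decide)
    (by decide)
  have T0 := t.dist_smul_touchpoint_singleton (i := 0) (j := 1) (k := 2) (by decide) (by decide)
    (by decide)
  have T1 := t.dist_smul_touchpoint_singleton (i := 1) (j := 0) (k := 2) (by decide) (by decide)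
    (by decide)
  have T2 := t.dist_smul_touchpoint_singleton (i := 2) (j := 0) (k := 1) (by decide) (by decide)
    (by decide)
  have hI := t.perimeter_smul_incenter
  simp only [dist_comm (t.points 1) (t.points 0), dist_comm (t.points 2) (t.points 0),
    dist_comm (t.points 2) (t.points 1)] at *
  have ha : 0 < dist (t.points 1) (t.points 2) :=
    dist_pos.2 (t.independent.injective.ne (by decide))
  have hb : 0 < dist (t.points 0) (t.points 2) :=
    dist_pos.2 (t.independent.injective.ne (by decide))
  have hc : 0 < dist (t.points 0) (t.points 1) :=
    dist_pos.2 (t.independent.injective.ne (by decide))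
  have hind := affineIndependent_iff.1 t.independent Finset.univ
  simp only [Nat.reduceAdd, Fin.sum_univ_three] at hind
  generalize dist (t.points 1) (t.points 2) = a at *
  generalize dist (t.points 0) (t.points 2) = b at *
  generalize dist (t.points 0) (t.points 1) = c at *
  rw [Fin.forall_fin_succ, Fin.forall_fin_two]
  simp only [Fin.succ_zero_eq_one, Fin.succ_one_eq_two]
  generalize t.touchpoint {0} 0 = D at *
  generalize t.touchpoint {1} 1 = E at *
  generalize t.touchpoint {2} 2 = F at *
  generalize t.points 0 = A at *
  generalize t.points 1 = B at *
  generalize t.points 2 = C at *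
  generalize t.incenter = I at *
  have hs : a + b + c ≠ 0 := by positivity
  -- One computation for all three cevians: `x` is the length of the side opposite `P`.
  have hN : ∀ {x : ℝ} {P T : V}, (2 * x) • T = (a + b + c) • (A + B + C) -
      (2 : ℝ) • (a • A + b • B + c • C) - (a + b + c - 2 * x) • P →
      A + B + C - (2 : ℝ) • I ∈ affineSpan ℝ {P, T} := by
    intro x P T h
    rw [mem_affineSpan_pair_iff_exists_lineMap_eq]
    refine ⟨2 * x / (a + b + c), smul_right_injective V hs ?_⟩
    simp only
    rw [AffineMap.lineMap_apply_module, smul_add, smul_smul, smul_smul, mul_div_cancel₀ _ hs, h,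
      mul_sub, mul_div_cancel₀ _ hs, smul_sub, smul_comm _ (2 : ℝ), hI]
    module
  constructor
  · rintro ⟨h0, h1, -⟩
    obtain ⟨u, rfl⟩ := mem_affineSpan_pair_iff_exists_lineMap_eq.1 h0
    obtain ⟨v, hv⟩ := mem_affineSpan_pair_iff_exists_lineMap_eq.1 h1
    -- Two cevians suffice for uniqueness. Rescaling the parameters lets `T0` and `T1` apply without
    -- division; affine independence then forces `p = q = 1 / (a + b + c)`.
    obtain ⟨p, rfl⟩ : ∃ p, u = p * (2 * a) := ⟨u / (2 * a), by field_simp⟩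
    obtain ⟨q, rfl⟩ : ∃ q, v = q * (2 * b) := ⟨v / (2 * b), by field_simp⟩
    rw [AffineMap.lineMap_apply_module, AffineMap.lineMap_apply_module, mul_smul p, mul_smul q, T0,
      T1] at hv
    have hw := hind ![1 - p * (2 * a) - q * (c + b - a),
      p * (c + a - b) - (1 - q * (2 * b)), p * (b + a - c) - q * (a + b - c)]
      (by simp; ring) (by
        simp only [Matrix.cons_val]
        rw [← sub_eq_zero] at hv
        rw [← neg_eq_zero, ← hv]
        module)
    have w0 : 1 - p * (2 * a) - q * (c + b - a) = 0 := hw 0 (Finset.mem_univ _)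
    have w2 : p * (b + a - c) - q * (a + b - c) = 0 := hw 2 (Finset.mem_univ _)
    have hpq : p = q := mul_left_cancel₀ (by linarith : a + b - c ≠ 0) (by linarith)
    subst hpq
    have hp : p * (a + b + c) = 1 := by linarith
    apply smul_right_injective V hs
    simp only
    rw [AffineMap.lineMap_apply_module, mul_smul p, T0, smul_sub, smul_comm _ (2 : ℝ), hI]
    match_scalars
    · linear_combination (-2 * a) * hp
    · linear_combination (c + a - b) * hp
    · linear_combination (b + a - c) * hp
  · rintro rfl
    refine ⟨hN (x := a) ?_, hN (x := b) ?_, hN (x := c) ?_⟩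
    · rw [T0]; module
    · rw [T1]; module
    · rw [T2]; module

end Affine.Triangle

/-! ### The nested caustic is the incircle -/

/-- A point strictly between an interior point and a point of an ellipse is interior. -/
theorem mem_ellipseInterior_of_sbtw {a b : ℝ} {p q x : Plane} (hp : p ∈ ellipseInterior a b)
    (hq : q ∈ ellipse a b) (hx : Sbtw ℝ p x q) : x ∈ ellipseInterior a b := by
  obtain ⟨⟨s, ⟨hs0, hs1⟩, rfl⟩, -, hne⟩ := hx
  have hs : s < 1 := lt_of_le_of_ne hs1 (by rintro rfl; simp at hne)
  simp only [ellipseInterior, ellipse, Set.mem_ofPred_eq] at *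
  simp only [AffineMap.lineMap_apply_module, PiLp.add_apply, PiLp.smul_apply, smul_eq_mul]
  have key : ((1 - s) * p 0 + s * q 0) ^ 2 / a ^ 2 + ((1 - s) * p 1 + s * q 1) ^ 2 / b ^ 2 =
      (1 - s) * (p 0 ^ 2 / a ^ 2 + p 1 ^ 2 / b ^ 2) + s * (q 0 ^ 2 / a ^ 2 + q 1 ^ 2 / b ^ 2) -
      s * (1 - s) * ((p 0 - q 0) ^ 2 / a ^ 2 + (p 1 - q 1) ^ 2 / b ^ 2) := by ring
  have h2 : 0 ≤ s * (1 - s) * ((p 0 - q 0) ^ 2 / a ^ 2 + (p 1 - q 1) ^ 2 / b ^ 2) :=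
    mul_nonneg (mul_nonneg hs0 (by linarith)) (by positivity)
  rw [key, hq]
  nlinarith

theorem affineSpan_faceOpposite_eq_pair (t : Affine.Triangle ℝ Plane) {i j k : Fin 3} (hij : i ≠ j)
    (hik : i ≠ k) (hjk : j ≠ k) :
    affineSpan ℝ (Set.range (t.faceOpposite i).points) =
      affineSpan ℝ {t.points j, t.points k} := by
  have hc : ({i}ᶜ : Set (Fin 3)) = {j, k} := by
    ext x
    simp only [Set.mem_compl_iff, Set.mem_singleton_iff, Set.mem_insert_iff]
    clear * - hij hik hjk
    decide +revert
  rw [Affine.Simplex.range_faceOpposite_points, hc, Set.image_pair]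

/-- A caustic circle nested in the ellipse is the incircle of each Poncelet triangle. -/
theorem IsPonceletTriangle.center_eq_incenter {a b : ℝ} {K : EuclideanGeometry.Sphere Plane}
    {t : Affine.Triangle ℝ Plane} (ht : IsPonceletTriangle (ellipse a b) K t)
    (hK : Metric.closedBall K.center K.radius ⊆ ellipseInterior a b) :
    K.center = t.incenter := by
  have hex : ∀ i : Fin 3, ∃ j k, i ≠ j ∧ i ≠ k ∧ j ≠ k := by decide
  have htan : ∀ i, K.IsTangent (affineSpan ℝ (Set.range (t.faceOpposite i).points)) := by
    intro i
    obtain ⟨j, k, hij, hik, hjk⟩ := hex i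
    rw [affineSpan_faceOpposite_eq_pair t hij hik hjk]
    exact ht.2 j k hjk
  have htop : affineSpan ℝ (Set.range t.points) = ⊤ := by
    rw [t.independent.affineSpan_eq_top_iff_card_eq_finrank_add_one]
    simp
  obtain ⟨signs, -, hs⟩ := (t.exists_forall_dist_eq_iff_exists_excenterExists_and_eq_excenter
    (p := K.center) (by rw [htop]; trivial)).1 ⟨K.radius, fun i ↦
      EuclideanGeometry.Sphere.dist_orthogonalProjection_eq_radius_iff_isTangent.2 (htan i)⟩
  rcases t.excenter_eq_incenter_or_excenter_singleton signs with h | ⟨i, h⟩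
  · rw [hs, h]
  -- If `K` were centred at the excenter opposite `i`, vertex `k` would lie strictly between the
  -- touchpoint `T`, interior by nesting, and vertex `i`, hence would be interior itself.
  · exfalso
    rw [h] at hs
    obtain ⟨j, k, hij, hik, hjk⟩ := hex i
    obtain ⟨T, hT⟩ := htan j
    have hT' : T = t.touchpoint {i} j := by
      rw [hT.eq_orthogonalProjection, Affine.Simplex.touchpoint,
        Affine.Simplex.orthogonalProjectionSpan, hs]
    have h1 := mem_ellipseInterior_of_sbtw (hK (Metric.mem_closedBall.2
      (EuclideanGeometry.mem_sphere.1 hT.mem_sphere).le)) (ht.1 i)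
      (hT' ▸ t.touchpoint_singleton_sbtw hij hik hjk)
    have h2 := ht.1 k
    simp only [ellipseInterior, ellipse, Set.mem_ofPred_eq] at h1 h2
    linarith

/-! ### Tangent chords in coordinates -/

/-- Tangency of a line through two points to a circle, in coordinates. -/
theorem isTangent_affineSpan_pair_iff {C P Q : Plane} {r : ℝ} (hr : 0 < r) (hPQ : P ≠ Q) :
    EuclideanGeometry.Sphere.IsTangent ⟨C, r⟩ (affineSpan ℝ {P, Q}) ↔
      ((Q 0 - P 0) * (C 1 - P 1) - (Q 1 - P 1) * (C 0 - P 0)) ^ 2 =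
        r ^ 2 * ((Q 0 - P 0) ^ 2 + (Q 1 - P 1) ^ 2) := by
  have hL : 0 < (Q 0 - P 0) ^ 2 + (Q 1 - P 1) ^ 2 := by
    refine lt_of_le_of_ne (by positivity) fun h ↦ hPQ ?_
    have h0 : Q 0 - P 0 = 0 := by nlinarith [sq_nonneg (Q 0 - P 0), sq_nonneg (Q 1 - P 1)]
    have h1 : Q 1 - P 1 = 0 := by nlinarith [sq_nonneg (Q 0 - P 0), sq_nonneg (Q 1 - P 1)]
    ext i
    fin_cases i
    · exact (sub_eq_zero.1 h0).symm
    · exact (sub_eq_zero.1 h1).symm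
  have hmem : ∀ x : Plane, x ∈ (⟨C, r⟩ : EuclideanGeometry.Sphere Plane) ↔
      (x 0 - C 0) ^ 2 + (x 1 - C 1) ^ 2 = r ^ 2 := by
    intro x
    rw [EuclideanGeometry.mem_sphere, EuclideanSpace.dist_eq, Fin.sum_univ_two, Real.dist_eq,
      Real.dist_eq, sq_abs, sq_abs, Real.sqrt_eq_iff_eq_sq (by positivity) hr.le]
  have horth : ∀ x y : Plane, y ∈ (⟨C, r⟩ : EuclideanGeometry.Sphere Plane).orthRadius x ↔
      (y 0 - x 0) * (x 0 - C 0) + (y 1 - x 1) * (x 1 - C 1) = 0 := by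
    intro x y
    rw [EuclideanGeometry.Sphere.mem_orthRadius_iff_inner_left]
    simp [PiLp.inner_apply, Fin.sum_univ_two, mul_comm]
  constructor
  · rintro ⟨p, h1, h2, h3⟩
    rw [hmem] at h1
    obtain ⟨s, rfl⟩ := mem_affineSpan_pair_iff_exists_lineMap_eq.1 h2
    have hP := (horth _ _).1 (h3 (left_mem_affineSpan_pair ℝ P Q))
    have hQ := (horth _ _).1 (h3 (right_mem_affineSpan_pair ℝ P Q))
    simp only [AffineMap.lineMap_apply_module, PiLp.add_apply, PiLp.smul_apply, smul_eq_mul]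
      at h1 hP hQ
    rw [← h1]
    have ho : (Q 0 - P 0) * ((1 - s) * P 0 + s * Q 0 - C 0) +
      (Q 1 - P 1) * ((1 - s) * P 1 + s * Q 1 - C 1) = 0 := by linear_combination hQ - hP
    linear_combination (-((Q 0 - P 0) * ((1 - s) * P 0 + s * Q 0 - C 0) +
      (Q 1 - P 1) * ((1 - s) * P 1 + s * Q 1 - C 1))) * ho
  · intro h
    -- `s` is the parameter of the foot of the perpendicular from `C`.
    obtain ⟨s, hs⟩ : ∃ s : ℝ, s * ((Q 0 - P 0) ^ 2 + (Q 1 - P 1) ^ 2) =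
      (Q 0 - P 0) * (C 0 - P 0) + (Q 1 - P 1) * (C 1 - P 1) := ⟨_, div_mul_cancel₀ _ hL.ne'⟩
    have ho : (Q 0 - P 0) * ((1 - s) * P 0 + s * Q 0 - C 0) +
      (Q 1 - P 1) * ((1 - s) * P 1 + s * Q 1 - C 1) = 0 := by linear_combination hs
    refine ⟨AffineMap.lineMap P Q s, ?_, AffineMap.lineMap_mem_affineSpan_pair _ _ _, ?_⟩
    · rw [hmem]
      simp only [AffineMap.lineMap_apply_module, PiLp.add_apply, PiLp.smul_apply, smul_eq_mul]
      apply mul_left_cancel₀ hL.ne'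
      linear_combination h + ((Q 0 - P 0) * ((1 - s) * P 0 + s * Q 0 - C 0) +
        (Q 1 - P 1) * ((1 - s) * P 1 + s * Q 1 - C 1)) * ho
    · apply affineSpan_pair_le_of_mem_of_mem
      · rw [horth]
        simp only [AffineMap.lineMap_apply_module, PiLp.add_apply, PiLp.smul_apply, smul_eq_mul]
        linear_combination -s * ho
      · rw [horth]
        simp only [AffineMap.lineMap_apply_module, PiLp.add_apply, PiLp.smul_apply, smul_eq_mul]
        linear_combination (1 - s) * ho

/-- For `z`, `w` on the unit circle, the signed area of `z`, `w`, `p` in terms of the equation of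
the line `z w`. -/
theorem four_mul_cross_sq {z w : ℂ} (hz : Complex.normSq z = 1) (hw : Complex.normSq w = 1)
    (p : ℂ) :
    4 * (z * w) * (((w.re - z.re) * (p.im - z.im) - (w.im - z.im) * (p.re - z.re)) ^ 2 : ℝ) =
      Complex.normSq (z - w) * (p + z * w * conj p - z - w) ^ 2 := by
  have hzz : z * conj z = 1 := by rw [Complex.mul_conj, hz, Complex.ofReal_one]
  have hww : w * conj w = 1 := by rw [Complex.mul_conj, hw, Complex.ofReal_one]
  have hzw : z * w ≠ 0 := mul_ne_zero (left_ne_zero_of_mul_eq_one hzz)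
    (left_ne_zero_of_mul_eq_one hww)
  have h1 : 2 * Complex.I *
      ((w.re - z.re) * (p.im - z.im) - (w.im - z.im) * (p.re - z.re) : ℝ) =
      conj (w - z) * (p - z) - (w - z) * conj (p - z) := by
    apply Complex.ext <;> simp <;> ring
  rw [← Complex.mul_conj]
  push_cast at h1 ⊢
  generalize ((w.re : ℂ) - z.re) * (p.im - z.im) - (w.im - z.im) * (p.re - z.re) = X at *
  simp only [map_sub] at h1 ⊢
  have h2 : z * w * (2 * Complex.I * X) = -(w - z) * (p + z * w * conj p - z - w) := by
    rw [h1]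
    linear_combination (z * (p - z)) * hww + (w * (w - z) - w * (p - z)) * hzz
  have h3 : z * w * ((z - w) * (conj z - conj w)) = -(z - w) ^ 2 := by
    linear_combination (z - w) * (w * hzz - z * hww)
  apply mul_left_cancel₀ hzw
  linear_combination (-(z * w * (2 * Complex.I * X)) + (w - z) * (p + z * w * conj p - z - w)) * h2
    - (p + z * w * conj p - z - w) ^ 2 * h3 + 4 * (z * w * X) ^ 2 * Complex.I_sq

/-- Uses `conj z = 1 / z` on the circle. The squared chord length in the plane is `c² (w.re - z.re)²
+ b² |z - w|²`, so this term carries the anisotropy, later absorbed by the offset of the foci. -/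
theorem four_mul_re_sub_sq {z w : ℂ} (hz : Complex.normSq z = 1) (hw : Complex.normSq w = 1) :
    4 * (z * w) * ((w.re - z.re) ^ 2 : ℝ) = -(Complex.normSq (z - w) * (1 - z * w) ^ 2) := by
  have hzz : z * conj z = 1 := by rw [Complex.mul_conj, hz, Complex.ofReal_one]
  have hww : w * conj w = 1 := by rw [Complex.mul_conj, hw, Complex.ofReal_one]
  have h3 : z * w * (conj z - conj w) = -(z - w) := by
    linear_combination w * hzz - z * hww
  rw [← Complex.mul_conj]
  push_cast
  rw [Complex.re_eq_add_conj, Complex.re_eq_add_conj]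
  simp only [map_sub]
  linear_combination (conj z - conj w + z * w * (z - w)) * h3

/-- Tangency of a chord of the ellipse to the circle with center `(xc, yc)` and radius `r`, in the
affine chart in which the ellipse is the unit circle and the circle is an ellipse with foci `f`
and `g`. -/
theorem chord_identity {a b c xc yc r : ℝ} (ha : a ≠ 0) (hb : b ≠ 0) (hc : c ^ 2 = a ^ 2 - b ^ 2)
    {z w : ℂ} (hz : Complex.normSq z = 1) (hw : Complex.normSq w = 1) {f g : ℂ}
    (hf : f = ⟨xc / a, yc / b + r * c / (a * b)⟩) (hg : g = ⟨xc / a, yc / b - r * c / (a * b)⟩) :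
    4 * (z * w) * (((a * w.re - a * z.re) * (yc - b * z.im) -
        (b * w.im - b * z.im) * (xc - a * z.re)) ^ 2 -
      r ^ 2 * ((a * w.re - a * z.re) ^ 2 + (b * w.im - b * z.im) ^ 2) : ℝ) =
    Complex.normSq (z - w) * (a * b) ^ 2 * ((f + z * w * conj f - z - w) *
      (g + z * w * conj g - z - w) - (4 * r ^ 2 / a ^ 2 : ℝ) * (z * w)) := by
  obtain ⟨p, hp⟩ : ∃ p : ℂ, p = ⟨xc / a, yc / b⟩ := ⟨_, rfl⟩
  obtain ⟨s, hs⟩ : ∃ s : ℝ, s = r * c / (a * b) := ⟨_, rfl⟩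
  have hx : xc = a * p.re := by rw [hp]; field_simp
  have hy : yc = b * p.im := by rw [hp]; field_simp
  have h1 := four_mul_cross_sq hz hw p
  have h2 := four_mul_re_sub_sq hz hw
  have hN : Complex.normSq (z - w) = (w.re - z.re) ^ 2 + (w.im - z.im) ^ 2 := by
    rw [Complex.normSq_apply, Complex.sub_re, Complex.sub_im]; ring
  have e1 : ((a * w.re - a * z.re) * (yc - b * z.im) -
        (b * w.im - b * z.im) * (xc - a * z.re)) ^ 2 -
      r ^ 2 * ((a * w.re - a * z.re) ^ 2 + (b * w.im - b * z.im) ^ 2) =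
      (a * b) ^ 2 * ((w.re - z.re) * (p.im - z.im) - (w.im - z.im) * (p.re - z.re)) ^ 2 -
      r ^ 2 * (c ^ 2 * (w.re - z.re) ^ 2 + b ^ 2 * Complex.normSq (z - w)) := by
    rw [hN, hc, hx, hy]
    ring
  -- With `Y = p + z w conj p - z - w`, the factors for the two foci are `Y ± i s (1 - z w)`, with
  -- product `Y² + s² (1 - z w)²`.
  have hf' : f = p + s * Complex.I := by
    rw [hf, hp, ← hs]; apply Complex.ext <;> simp
  have hg' : g = p - s * Complex.I := by
    rw [hg, hp, ← hs]; apply Complex.ext <;> simp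
  have e2 : (a * b) ^ 2 * s ^ 2 = r ^ 2 * c ^ 2 := by rw [hs]; field_simp
  have e3 : (a * b) ^ 2 * (4 * r ^ 2 / a ^ 2) = 4 * r ^ 2 * b ^ 2 := by field_simp
  have e2' := congrArg (Complex.ofReal) e2
  have e3' := congrArg (Complex.ofReal) e3
  rw [e1, hf', hg']
  generalize 4 * r ^ 2 / a ^ 2 = m at *
  simp only [map_add, map_sub, map_mul, Complex.conj_ofReal, Complex.conj_I]
  push_cast at h1 h2 e2' e3' ⊢
  generalize (Complex.normSq (z - w) : ℂ) = N at *
  linear_combination (a * b : ℂ) ^ 2 * h1 - (r : ℂ) ^ 2 * c ^ 2 * h2 + N * z * w * e3' -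
    N * (1 - z * w) ^ 2 * e2' + N * (a * b * s * (1 - z * w) : ℂ) ^ 2 * Complex.I_sq

/-! ### The chart and the Poncelet triangles in it -/

/-- The linear chart `x + i y ↦ (a x, b y)`, carrying the unit circle to `ellipse a b`. -/
noncomputable def ellipseChart (a b : ℝ) : ℂ →ₗ[ℝ] Plane where
  toFun z := !₂[a * z.re, b * z.im]
  map_add' z w := by ext i; fin_cases i <;> simp [mul_add]
  map_smul' s z := by ext i; fin_cases i <;> simp [mul_left_comm]

@[simp] theorem ellipseChart_apply_zero (a b : ℝ) (z : ℂ) : ellipseChart a b z 0 = a * z.re := rfl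

@[simp] theorem ellipseChart_apply_one (a b : ℝ) (z : ℂ) : ellipseChart a b z 1 = b * z.im := rfl

theorem ellipseChart_mk {a b : ℝ} (ha : a ≠ 0) (hb : b ≠ 0) (p : Plane) :
    ellipseChart a b ⟨p 0 / a, p 1 / b⟩ = p := by
  ext i
  fin_cases i
  · exact mul_div_cancel₀ _ ha
  · exact mul_div_cancel₀ _ hb

theorem ellipseChart_injective {a b : ℝ} (ha : a ≠ 0) (hb : b ≠ 0) :
    Function.Injective (ellipseChart a b) := by
  intro z w h
  apply Complex.ext
  · exact mul_left_cancel₀ ha (congrArg (fun p : Plane ↦ p 0) h)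
  · exact mul_left_cancel₀ hb (congrArg (fun p : Plane ↦ p 1) h)

theorem ellipseChart_mem_ellipse_iff {a b k : ℝ} (ha : a ≠ 0) (hb : b ≠ 0) (hk : k ≠ 0) (z : ℂ) :
    ellipseChart a b z ∈ ellipse (a * k) (b * k) ↔ Complex.normSq z = k ^ 2 := by
  have : (a * z.re) ^ 2 / (a * k) ^ 2 + (b * z.im) ^ 2 / (b * k) ^ 2 =
      Complex.normSq z / k ^ 2 := by
    rw [Complex.normSq_apply]
    field_simp
  simp only [ellipse, Set.mem_ofPred_eq, ellipseChart_apply_zero, ellipseChart_apply_one, this]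
  rw [div_eq_one_iff_eq (pow_ne_zero 2 hk)]

theorem ellipseChart_mem_ellipse_one_iff {a b : ℝ} (ha : a ≠ 0) (hb : b ≠ 0) (z : ℂ) :
    ellipseChart a b z ∈ ellipse a b ↔ Complex.normSq z = 1 := by
  simpa using ellipseChart_mem_ellipse_iff ha hb one_ne_zero z

theorem isTangent_chord_iff {a b c xc yc r : ℝ} (ha : 0 < a) (hb : 0 < b) (hr : 0 < r)
    (hc : c ^ 2 = a ^ 2 - b ^ 2) {z w : ℂ} (hz : Complex.normSq z = 1) (hw : Complex.normSq w = 1)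
    (hzw : z ≠ w) {f g : ℂ}
    (hf : f = ⟨xc / a, yc / b + r * c / (a * b)⟩) (hg : g = ⟨xc / a, yc / b - r * c / (a * b)⟩) :
    EuclideanGeometry.Sphere.IsTangent ⟨!₂[xc, yc], r⟩
        (affineSpan ℝ {ellipseChart a b z, ellipseChart a b w}) ↔
      (f + z * w * conj f - z - w) * (g + z * w * conj g - z - w) =
        (4 * r ^ 2 / a ^ 2 : ℝ) * (z * w) := by
  rw [isTangent_affineSpan_pair_iff hr ((ellipseChart_injective ha.ne' hb.ne').ne hzw)]
  have h := chord_identity ha.ne' hb.ne' hc hz hw hf hg (xc := xc) (yc := yc) (r := r)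
  have hN : (Complex.normSq (z - w) : ℂ) * (a * b) ^ 2 ≠ 0 := by
    have := Complex.normSq_pos.2 (sub_ne_zero.2 hzw)
    exact_mod_cast (by positivity : Complex.normSq (z - w) * (a * b) ^ 2 ≠ 0)
  have hq : 4 * (z * w) ≠ 0 := by
    refine mul_ne_zero (by norm_num) (mul_ne_zero ?_ ?_) <;> rintro rfl <;> simp at hz hw
  rw [← sub_eq_zero, ← sub_eq_zero (b := _ * (z * w)), ← mul_eq_zero_iff_left hN, ← h,
    mul_eq_zero_iff_left hq, Complex.ofReal_eq_zero]
  rfl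

/-- The focus is the image of a point at distance `r |c| / a < r` from the center of the disk. Only
`c ^ 2` is prescribed, so `-c` gives the other focus. -/
theorem normSq_focus_lt_one {a b c xc yc r : ℝ} (hb : 0 < b) (hab : b < a) (hr : 0 < r)
    (hc : c ^ 2 = a ^ 2 - b ^ 2)
    (hK : Metric.closedBall !₂[xc, yc] r ⊆ ellipseInterior a b) :
    Complex.normSq ⟨xc / a, yc / b + r * c / (a * b)⟩ < 1 := by
  have ha : 0 < a := hb.trans hab
  have hmem : !₂[xc, yc + r * c / a] ∈ Metric.closedBall (!₂[xc, yc] : Plane) r := by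
    rw [Metric.mem_closedBall, EuclideanSpace.dist_eq, Fin.sum_univ_two, Real.dist_eq,
      Real.dist_eq, sq_abs, sq_abs]
    apply Real.sqrt_le_iff.2 ⟨hr.le, ?_⟩
    have : (r * c / a) ^ 2 ≤ r ^ 2 := by
      rw [div_pow, mul_pow, hc, div_le_iff₀ (by positivity)]
      nlinarith [mul_pos (sq_pos_of_pos hr) (sq_pos_of_pos hb)]
    simpa using this
  have h := hK hmem
  simp only [ellipseInterior, Set.mem_ofPred_eq] at h
  rw [Complex.normSq_apply]
  refine lt_of_eq_of_lt ?_ h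
  simp
  field_simp

/-- The Poncelet condition, the description of the vertices of a Poncelet triangle in the chart. -/
theorem IsPonceletTriangle.exists_chart {a b c xc yc r : ℝ} (ha : 0 < a) (hb : 0 < b) (hr : 0 < r)
    (hc : c ^ 2 = a ^ 2 - b ^ 2) {f g : ℂ}
    (hf : f = ⟨xc / a, yc / b + r * c / (a * b)⟩) (hg : g = ⟨xc / a, yc / b - r * c / (a * b)⟩)
    {t : Affine.Triangle ℝ Plane} (ht : IsPonceletTriangle (ellipse a b) ⟨!₂[xc, yc], r⟩ t) :
    4 * r ^ 2 / a ^ 2 = (1 - Complex.normSq f) * (1 - Complex.normSq g) ∧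
      ∃ l : ℂ, Complex.normSq l = 1 ∧ t.points 0 + t.points 1 + t.points 2 =
        ellipseChart a b (f + g + l * (conj f * conj g)) := by
  obtain ⟨z, hz⟩ : ∃ z : Fin 3 → ℂ, ∀ i, t.points i = ellipseChart a b (z i) :=
    ⟨fun i ↦ ⟨t.points i 0 / a, t.points i 1 / b⟩, fun i ↦ (ellipseChart_mk ha.ne' hb.ne' _).symm⟩
  have hn : ∀ i, Complex.normSq (z i) = 1 := fun i ↦ by
    rw [← ellipseChart_mem_ellipse_one_iff ha.ne' hb.ne', ← hz]
    exact ht.1 i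
  have hne : ∀ i j, i ≠ j → z i ≠ z j := by
    intro i j hij h
    exact t.independent.injective.ne hij (by rw [hz, hz, h])
  have hne0 : ∀ i, z i ≠ 0 := by
    intro i h
    have := hn i
    simp [h] at this
  have hrel : ∀ i j, i ≠ j → _ := fun i j hij ↦
    (isTangent_chord_iff ha hb hr hc (hn i) (hn j) (hne i j hij) hf hg).1
      (by rw [← hz, ← hz]; exact ht.2 i j hij)
  have h01 := hrel 0 1 (by decide)
  obtain ⟨e1, e2⟩ := symm_of_chord_relations (hne 0 1 (by decide)) (hne 0 2 (by decide))
    (hne 1 2 (by decide)) h01 (hrel 0 2 (by decide)) (hrel 1 2 (by decide))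
  constructor
  -- The same chord relation holds with constant `4 r² / a²` by tangency and `(1 - |f|²) (1 - |g|²)`
  -- by the symmetric functions; equating them is the closure condition.
  · have h := h01.symm.trans (chord_relation_of_symm e1 e2 (hne0 2))
    have h := mul_right_cancel₀ (mul_ne_zero (hne0 0) (hne0 1)) h
    rw [Complex.mul_conj, Complex.mul_conj] at h
    exact_mod_cast h
  · refine ⟨z 0 * z 1 * z 2, by simp [hn], ?_⟩
    rw [← e1, map_add, map_add, hz, hz, hz]

/-- Closure makes the Blaschke chords tangent for every unimodular `l`; hence the locus is the whole
ellipse rather than a subset. -/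
theorem exists_isPonceletTriangle {a b c xc yc r : ℝ} (ha : 0 < a) (hb : 0 < b) (hr : 0 < r)
    (hc : c ^ 2 = a ^ 2 - b ^ 2) {f g l : ℂ}
    (hf : f = ⟨xc / a, yc / b + r * c / (a * b)⟩) (hg : g = ⟨xc / a, yc / b - r * c / (a * b)⟩)
    (hf1 : Complex.normSq f < 1) (hg1 : Complex.normSq g < 1) (hl : Complex.normSq l = 1)
    (hP : 4 * r ^ 2 / a ^ 2 = (1 - Complex.normSq f) * (1 - Complex.normSq g)) :
    ∃ t : Affine.Triangle ℝ Plane, IsPonceletTriangle (ellipse a b) ⟨!₂[xc, yc], r⟩ t ∧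
      t.points 0 + t.points 1 + t.points 2 =
        ellipseChart a b (f + g + l * (conj f * conj g)) := by
  obtain ⟨z, hsum, hn, hz⟩ := exists_poncelet_triple hf1 hg1 hl
  have hind : AffineIndependent ℝ z := by
    refine EuclideanGeometry.Cospherical.affineIndependent (s := Set.range z) ⟨0, 1, ?_⟩
      subset_rfl fun i j hij ↦ ?_
    · rintro _ ⟨i, rfl⟩
      rw [dist_zero_right, ← sq_eq_sq₀ (norm_nonneg _) zero_le_one, ← Complex.normSq_eq_norm_sq,
        hn, one_pow]
    · by_contra hne
      exact (hz i j hne).1 hij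
  refine ⟨⟨ellipseChart a b ∘ z, hind.map' (ellipseChart a b).toAffineMap
    (ellipseChart_injective ha.ne' hb.ne')⟩, ⟨fun i ↦ ?_, fun i j hij ↦ ?_⟩, ?_⟩
  · exact (ellipseChart_mem_ellipse_one_iff ha.ne' hb.ne' _).2 (hn i)
  · refine (isTangent_chord_iff ha hb hr hc (hn i) (hn j) (hz i j hij).1 hf hg).2 ?_
    rw [(hz i j hij).2, hP, Complex.mul_conj, Complex.mul_conj]
    push_cast
    rfl
  · rw [← hsum, map_add, map_add]
    rfl

/-- The Nagel locus is the image in the chart of the circle of radius `|f g|`. -/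
theorem nagelLocus_eq_image {a b c xc yc r : ℝ} (hb : 0 < b) (hab : b < a) (hr : 0 < r)
    (hc : c ^ 2 = a ^ 2 - b ^ 2) {f g : ℂ}
    (hf : f = ⟨xc / a, yc / b + r * c / (a * b)⟩) (hg : g = ⟨xc / a, yc / b - r * c / (a * b)⟩)
    (hf1 : Complex.normSq f < 1) (hg1 : Complex.normSq g < 1)
    (hK : Metric.closedBall !₂[xc, yc] r ⊆ ellipseInterior a b)
    (hP : 4 * r ^ 2 / a ^ 2 = (1 - Complex.normSq f) * (1 - Complex.normSq g)) :
    nagelLocus (ellipse a b) ⟨!₂[xc, yc], r⟩ =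
      ellipseChart a b '' {m | Complex.normSq m = Complex.normSq (f * g)} := by
  have ha : 0 < a := hb.trans hab
  have hC : (2 : ℝ) • (!₂[xc, yc] : Plane) = ellipseChart a b (f + g) := by
    ext i
    fin_cases i
    · simp [hf, hg]; field_simp; ring
    · simp [hf, hg]; field_simp; ring
  have hN : ∀ (t : Affine.Triangle ℝ Plane) (l : ℂ) (X : Plane),
      IsPonceletTriangle (ellipse a b) ⟨!₂[xc, yc], r⟩ t → t.points 0 + t.points 1 + t.points 2 =
        ellipseChart a b (f + g + l * (conj f * conj g)) →
      (IsNagelPoint t X ↔ X = ellipseChart a b (l * (conj f * conj g))) := by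
    intro t l X ht hs
    have hI : !₂[xc, yc] = t.incenter := ht.center_eq_incenter hK
    rw [IsNagelPoint, t.forall_mem_affineSpan_touchpoint_iff, hs, ← hI, hC, ← map_sub,
      add_sub_cancel_left]
  ext X
  constructor
  · rintro ⟨t, ht, hX⟩
    obtain ⟨-, l, hl, hs⟩ := ht.exists_chart ha hb hr hc hf hg
    exact ⟨_, by simp [hl], ((hN t l X ht hs).1 hX).symm⟩
  · rintro ⟨m, hm, rfl⟩
    simp only [Set.mem_ofPred_eq] at hm
    obtain ⟨l, hl, rfl⟩ : ∃ l : ℂ, Complex.normSq l = 1 ∧ m = l * (conj f * conj g) := by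
      -- When `f g = 0` the Nagel point does not depend on `l`, so `1` serves.
      by_cases h0 : f * g = 0
      · refine ⟨1, map_one _, ?_⟩
        rw [h0, map_zero, Complex.normSq_eq_zero] at hm
        rw [hm, ← map_mul, h0, map_zero, mul_zero]
      · have h1 : conj f * conj g ≠ 0 := by rwa [← map_mul, Ne, map_eq_zero]
        refine ⟨m / (conj f * conj g), ?_, (div_mul_cancel₀ _ h1).symm⟩
        rw [map_div₀, hm, ← map_mul, Complex.normSq_conj, div_self]
        rwa [Ne, Complex.normSq_eq_zero]
    obtain ⟨t, ht, hs⟩ := exists_isPonceletTriangle ha hb hr hc hf hg hf1 hg1 hl hP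
    exact ⟨t, ht, (hN t l _ ht hs).2 rfl⟩

/-! ### The size of the locus -/

/-- The radius of a caustic circle determines the product of the foci. -/
theorem poncelet_radius_relation {a b c xc yc r δ : ℝ} (hb : 0 < b) (hab : b < a) (hr : 0 < r)
    (hc : c ^ 2 = a ^ 2 - b ^ 2)
    (hδ : δ = Real.sqrt ((b ^ 4 + c ^ 2 * yc ^ 2) * (a ^ 4 - c ^ 2 * xc ^ 2))) {f g : ℂ}
    (hf : f = ⟨xc / a, yc / b + r * c / (a * b)⟩) (hg : g = ⟨xc / a, yc / b - r * c / (a * b)⟩)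
    (hf1 : Complex.normSq f < 1) (hg1 : Complex.normSq g < 1)
    (hP : 4 * r ^ 2 / a ^ 2 = (1 - Complex.normSq f) * (1 - Complex.normSq g)) :
    (a * b * c ^ 2) ^ 2 * Complex.normSq (f * g) =
      (a ^ 3 * b + a * b ^ 3 - 2 * δ) ^ 2 + 4 * c ^ 4 * xc ^ 2 * yc ^ 2 := by
  have ha : 0 < a := hb.trans hab
  rw [map_mul]
  rw [hf, Complex.normSq_apply] at hf1 hP ⊢
  rw [hg, Complex.normSq_apply] at hg1 hP ⊢
  simp only at hf1 hg1 hP ⊢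
  obtain ⟨u, rfl⟩ : ∃ u, xc = a * u := ⟨xc / a, by field_simp⟩
  obtain ⟨v, rfl⟩ : ∃ v, yc = b * v := ⟨yc / b, by field_simp⟩
  obtain ⟨R, rfl⟩ : ∃ R, r = a * b * R := ⟨r / (a * b), by field_simp⟩
  have hs : a * b * R * c / (a * b) = R * c := by field_simp
  have hR : 0 < R := by
    by_contra h
    nlinarith [mul_pos ha hb]
  rw [mul_div_cancel_left₀ _ ha.ne', mul_div_cancel_left₀ _ hb.ne', hs] at hf1 hg1 hP ⊢
  have hP' : 4 * b ^ 2 * R ^ 2 = (1 - (u * u + (v + R * c) * (v + R * c))) *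
      (1 - (u * u + (v - R * c) * (v - R * c))) := by
    rw [← hP]; field_simp
  -- The mean of `1 - |f|²` and `1 - |g|²`; its sign selects the root in `hWQ`.
  have hW : 0 < 1 - u ^ 2 - v ^ 2 - R ^ 2 * c ^ 2 := by nlinarith
  set Q := Real.sqrt (b ^ 2 + c ^ 2 * v ^ 2) with hQ
  have hQ2 : Q ^ 2 = b ^ 2 + c ^ 2 * v ^ 2 := Real.sq_sqrt (by positivity)
  have hQ0 : 0 ≤ Q := Real.sqrt_nonneg _
  have hWQ : 1 - u ^ 2 - v ^ 2 - R ^ 2 * c ^ 2 = 2 * R * Q := by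
    rw [← sq_eq_sq₀ hW.le (by positivity)]
    linear_combination -hP' - 4 * R ^ 2 * hQ2
  -- Completing the square in the quadratic `hWQ` for `R`; thus `δ` factors with no nested root.
  have hPQ : (c ^ 2 * R + Q) ^ 2 = a ^ 2 - c ^ 2 * u ^ 2 := by
    linear_combination hQ2 - c ^ 2 * hWQ + hc
  have hδ' : δ = a * b * (Q * (c ^ 2 * R + Q)) := by
    have h : (b ^ 4 + c ^ 2 * (b * v) ^ 2) * (a ^ 4 - c ^ 2 * (a * u) ^ 2) =
        (a * b * (Q * (c ^ 2 * R + Q))) ^ 2 := by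
      linear_combination -(a ^ 2 * b ^ 2 * (c ^ 2 * R + Q) ^ 2) * hQ2 -
        a ^ 2 * b ^ 2 * (b ^ 2 + c ^ 2 * v ^ 2) * hPQ
    rw [hδ, h, Real.sqrt_sq (by positivity)]
  -- The bracket is the real part of `f g = (u + i v)² + R² c²`; the imaginary part `2 u v` supplies
  -- the other term of `δ8`.
  have h : a * b * c ^ 2 * (u ^ 2 - v ^ 2 + R ^ 2 * c ^ 2) = a ^ 3 * b + a * b ^ 3 - 2 * δ := by
    linear_combination a * b * (hPQ + hQ2) + 2 * hδ'
  rw [← h]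
  ring

/-- The Nagel locus over the Poncelet triangles between an ellipse and a nested circle is an
ellipse concentric with and homothetic to the outer one, or its center. -/
theorem mainTheorem9 (a b c xc yc r δ δ8 a8 b8 : ℝ) (K : EuclideanGeometry.Sphere Plane)
    (hb : 0 < b) (hab : b < a) (hr : 0 < r)
    (hc : c = Real.sqrt (a ^ 2 - b ^ 2))
    (hK : K = ⟨!₂[xc, yc], r⟩)
    (hnested : Metric.closedBall K.center K.radius ⊆ ellipseInterior a b)
    (hPoncelet : ∃ t : Affine.Triangle ℝ Plane, IsPonceletTriangle (ellipse a b) K t)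
    (hδ : δ = Real.sqrt ((b ^ 4 + c ^ 2 * yc ^ 2) * (a ^ 4 - c ^ 2 * xc ^ 2)))
    (hδ8 : δ8 = (a ^ 3 * b + a * b ^ 3 - 2 * δ) ^ 2 + 4 * c ^ 4 * xc ^ 2 * yc ^ 2)
    (ha8 : a8 = Real.sqrt δ8 / (b * c ^ 2))
    (hb8 : b8 = Real.sqrt δ8 / (a * c ^ 2)) :
    -- the nondegenerate case: an ellipse, concentric with and homothetic to the outer one
    (δ8 ≠ 0 →
      0 < a8 ∧ 0 < b8 ∧ nagelLocus (ellipse a b) K = ellipse a8 b8 ∧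
        ∃ k : ℝ, 0 < k ∧
          nagelLocus (ellipse a b) K = AffineMap.homothety (0 : Plane) k '' ellipse a b) ∧
    -- the degenerate case: the Nagel point is stationary at the common centre
    (δ8 = 0 → nagelLocus (ellipse a b) K = {0}) := by
  have ha : 0 < a := hb.trans hab
  have hc2 : c ^ 2 = a ^ 2 - b ^ 2 := by
    rw [hc, Real.sq_sqrt]
    nlinarith
  have hc0 : 0 < c ^ 2 := by
    rw [hc2]
    nlinarith
  subst hK
  obtain ⟨f, hf⟩ : ∃ f : ℂ, f = ⟨xc / a, yc / b + r * c / (a * b)⟩ := ⟨_, rfl⟩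
  obtain ⟨g, hg⟩ : ∃ g : ℂ, g = ⟨xc / a, yc / b - r * c / (a * b)⟩ := ⟨_, rfl⟩
  have hf1 : Complex.normSq f < 1 := hf ▸ normSq_focus_lt_one hb hab hr hc2 hnested
  have hg1 : Complex.normSq g < 1 := by
    have := normSq_focus_lt_one (c := -c) hb hab hr (by rwa [neg_sq]) hnested
    rwa [mul_neg, neg_div, ← sub_eq_add_neg, ← hg] at this
  obtain ⟨t, ht⟩ := hPoncelet
  obtain ⟨hP, -⟩ := ht.exists_chart ha hb hr hc2 hf hg
  have hL := nagelLocus_eq_image hb hab hr hc2 hf hg hf1 hg1 hnested hP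
  have hrel := poncelet_radius_relation hb hab hr hc2 hδ hf hg hf1 hg1 hP
  rw [← hδ8] at hrel
  have hpos : 0 < a * b * c ^ 2 := by positivity
  constructor
  · intro h8
    have h8' : 0 < δ8 := lt_of_le_of_ne (by rw [hδ8]; positivity) (Ne.symm h8)
    -- The homothety ratio, equal to `|f g|`.
    obtain ⟨k, hk⟩ : ∃ k, k = Real.sqrt δ8 / (a * b * c ^ 2) := ⟨_, rfl⟩
    have hk0 : 0 < k := by rw [hk]; positivity
    have hkn : Complex.normSq (f * g) = k ^ 2 := by
      rw [hk, div_pow, Real.sq_sqrt h8'.le, ← hrel,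
        mul_div_cancel_left₀ _ (pow_pos hpos 2).ne']
    have ha8' : a8 = a * k := by rw [ha8, hk]; field_simp
    have hb8' : b8 = b * k := by rw [hb8, hk]; field_simp
    refine ⟨by rw [ha8']; positivity, by rw [hb8']; positivity, ?_, k, hk0, ?_⟩
    · rw [hL, ha8', hb8', hkn]
      ext X
      rw [← ellipseChart_mk ha.ne' hb.ne' X, (ellipseChart_injective ha.ne' hb.ne').mem_set_image,
        ellipseChart_mem_ellipse_iff ha.ne' hb.ne' hk0.ne']
      rfl
    · rw [hL, hkn]
      ext X
      constructor
      · rintro ⟨m, hm, rfl⟩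
        refine ⟨ellipseChart a b (k⁻¹ • m), ?_, ?_⟩
        · rw [ellipseChart_mem_ellipse_one_iff ha.ne' hb.ne', Complex.real_smul, map_mul,
            Complex.normSq_ofReal, show Complex.normSq m = k ^ 2 from hm]
          field_simp
        · rw [map_smul]
          simp [-Complex.real_smul, AffineMap.homothety_apply, smul_smul, hk0.ne']
      · rintro ⟨Y, hY, rfl⟩
        rw [← ellipseChart_mk ha.ne' hb.ne' Y, ellipseChart_mem_ellipse_one_iff ha.ne' hb.ne'] at hY
        refine ⟨k • ⟨Y 0 / a, Y 1 / b⟩, ?_, ?_⟩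
        · rw [Set.mem_ofPred_eq, Complex.real_smul, map_mul, hY, Complex.normSq_ofReal]
          ring
        · rw [map_smul, ellipseChart_mk ha.ne' hb.ne']
          simp [AffineMap.homothety_apply]
  · intro h8
    have h0 : Complex.normSq (f * g) = 0 := by
      rw [h8] at hrel
      exact (mul_eq_zero.1 hrel).resolve_left (by positivity)
    rw [hL, h0]
    simp
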